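/- For a bounded real sequence $x=(x(n))_{n\in\mathbb{N}}\in\ell_\infty$ (real scalars), a number $\eta\in\mathbb{R}$ is an accumulation point of $x$ if $\{n\in\mathbb{N}: |x(n)-\eta|<\varepsilon\}$ is infinite for every $\varepsilon>0$. For a cardinal $\kappa$, let $\mathrm{L}(\kappa)$ be the set of all $x\in\ell_\infty$ having exactly $\kappa$ accumulation points. A subset $M$ of a vector space is called $2$-lineable if $M\cup\{0\}$ contains a linear subspace of dimension $2$. Let $(a_n)_{n\ge 0}$ be an increasing sequence of natural numbers such that $a_0\ge 2$ and $a_{n+1}>2a_n$ for all $n\ge 0$. Then $\bigcup_{n\ge 0}\mathrm{L}(a_n)$ is not $2$-lineable. In particular, $\bigcup_{n\ge 2}\mathrm{L}(n!)$ and $\bigcup_{n\ge 1}\mathrm{L}(3^n)$ are not $2$-lineable. -/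

import Mathlib

open scoped ENNReal lp Nat

universe u v

/-- A subset `M` of a `𝕜`-vector space `X` is `κ`-lineable if `M ∪ {0}` contains a linear
subspace of (algebraic) dimension `κ`. -/
def IsLineable (𝕜 : Type v) {X : Type u} [Field 𝕜] [AddCommGroup X] [Module 𝕜 X]
    (κ : Cardinal.{u}) (M : Set X) : Prop :=
  ∃ V : Submodule 𝕜 X, Module.rank 𝕜 V = κ ∧ (V : Set X) ⊆ M ∪ {0}

/-- The set `L_x` of accumulation points of a bounded real sequence `x`: the reals `η` such that
`x n` is `ε`-close to `η` for infinitely many `n`, for every `ε > 0`. -/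
def accumulationPoints (x : ℓ^∞(ℕ, ℝ)) : Set ℝ :=
  {η : ℝ | ∀ ε : ℝ, 0 < ε → {n : ℕ | |x n - η| < ε}.Infinite}

/-- The set `L(κ)` of bounded real sequences with exactly `κ` accumulation points. -/
def seqWithAccumulationPoints (κ : Cardinal.{0}) : Set ℓ^∞(ℕ, ℝ) :=
  {x | Cardinal.mk (accumulationPoints x) = κ}

open Filter Topology

/-! Let `x`, `y` span the plane and let `P` be the set of joint cluster points of `(x n, y n)`. By
compactness the accumulation points of `α • x + β • y` are the image of `P` under the form `(α, β)`,
so `P` is finite and every nonzero form takes an admissible number of values on it. A generic form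
is injective on `P`, so `P.card` is itself admissible. Take a form `u` identifying two points of
`P`, and the last non-injective form `v` in a pencil `w + t u`. Then `P` is a chain for `(u, v)`,
whence `P.card ≤ (P.image u).card + (P.image v).card`. Both images are smaller than `P` and of
admissible size, hence less than half of `P.card`: a contradiction. -/

/-- A finite set on which `u` and `v` are similarly ordered and jointly injective is a chain in the
product of the images of `u` and `v`, so its size is at most the sum of the sizes of the images. -/
theorem card_le_card_image_add_card_image {ι : Type*} (Q : Finset ι) (u v : ι → ℝ)
    (hmono : ∀ p ∈ Q, ∀ q ∈ Q, 0 ≤ (u p - u q) * (v p - v q))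
    (hinj : ∀ p ∈ Q, ∀ q ∈ Q, u p = u q → v p = v q → p = q) :
    Q.card ≤ (Q.image u).card + (Q.image v).card := by
  classical
  -- Rank of `w p` among the values of `w`. The sum of the `u`- and `v`-ranks increases strictly
  -- along the chain, so it is injective.
  let r : (ι → ℝ) → ι → ℕ := fun w p => ((Q.image w).filter (· < w p)).card
  have hle : ∀ (w : ι → ℝ) (p q : ι), w p ≤ w q → r w p ≤ r w q := fun w p q h =>
    Finset.card_le_card fun a ha => by
      rw [Finset.mem_filter] at ha ⊢
      exact ⟨ha.1, ha.2.trans_le h⟩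
  have hlt : ∀ (w : ι → ℝ), ∀ p ∈ Q, ∀ q, w p < w q → r w p < r w q := fun w p hp q h =>
    Finset.card_lt_card <| (Finset.ssubset_iff_of_subset fun a ha => by
      rw [Finset.mem_filter] at ha ⊢
      exact ⟨ha.1, ha.2.trans h⟩).2
      ⟨w p, Finset.mem_filter.2 ⟨Finset.mem_image_of_mem w hp, h⟩, by simp⟩
  have hbound : ∀ (w : ι → ℝ), ∀ p ∈ Q, r w p < (Q.image w).card := fun w p hp =>
    Finset.card_lt_card <| (Finset.ssubset_iff_of_subset (Finset.filter_subset _ _)).2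
      ⟨w p, Finset.mem_image_of_mem w hp, by simp⟩
  have hrank : ∀ p ∈ Q, ∀ q ∈ Q, u p < u q ∨ v p < v q → r u p + r v p < r u q + r v q := by
    intro p hp q hq h
    have hm := hmono p hp q hq
    rcases h with h | h
    · have : v p ≤ v q := by
        by_contra! hv
        nlinarith [mul_pos (sub_pos.2 h) (sub_pos.2 hv)]
      exact add_lt_add_of_lt_of_le (hlt u p hp q h) (hle v p q this)
    · have : u p ≤ u q := by
        by_contra! hu
        nlinarith [mul_pos (sub_pos.2 h) (sub_pos.2 hu)]
      exact add_lt_add_of_le_of_lt (hle u p q this) (hlt v p hp q h)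
  rw [← Finset.card_range ((Q.image u).card + (Q.image v).card)]
  refine Finset.card_le_card_of_injOn (fun p => r u p + r v p) ?_ ?_
  · intro p hp
    simpa using add_lt_add (hbound u p hp) (hbound v p hp)
  · intro p hp q hq h
    by_contra hpq
    have hne : u p ≠ u q ∨ v p ≠ v q := by
      by_contra! h'
      exact hpq (hinj p hp q hq h'.1 h'.2)
    have : (u p < u q ∨ v p < v q) ∨ (u q < u p ∨ v q < v p) := by
      rcases hne with h' | h' <;> rcases h'.lt_or_gt with h'' | h'' <;> tauto
    rcases this with h' | h'
    · exact (hrank p hp q hq h').ne h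
    · exact (hrank q hq p hp h').ne h.symm

/-- In the pencil `w + t u`, the last member that is not injective on `Q` is similarly ordered
to `u`, and every later member is injective on `Q`. -/
theorem exists_last_not_injOn {ι : Type*} (Q : Finset ι) (u w : ι → ℝ)
    (hinj : ∀ p ∈ Q, ∀ q ∈ Q, u p = u q → w p = w q → p = q)
    (hu : 1 < (Q.image u).card) :
    ∃ t : ℝ, ¬ Set.InjOn (fun p => w p + t * u p) Q ∧
      (∀ p ∈ Q, ∀ q ∈ Q, 0 ≤ (u p - u q) * ((w p + t * u p) - (w q + t * u q))) ∧
      ∀ s, t < s → Set.InjOn (fun p => w p + s * u p) Q := by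
  classical
  let D := (Q ×ˢ Q).filter fun z => u z.1 ≠ u z.2
  -- The parameter at which the pencil identifies the two points. Distinct points with equal `u` are
  -- never identified, so `D` omits them.
  let c : ι × ι → ℝ := fun z => -(w z.1 - w z.2) / (u z.1 - u z.2)
  have hD : D.Nonempty := by
    obtain ⟨a, ha, b, hb, hab⟩ := Finset.one_lt_card.1 hu
    obtain ⟨p, hp, rfl⟩ := Finset.mem_image.1 ha
    obtain ⟨q, hq, rfl⟩ := Finset.mem_image.1 hb
    exact ⟨(p, q), by simp [D, hp, hq, hab]⟩
  obtain ⟨⟨p₀, q₀⟩, h₀, hmax⟩ := Finset.exists_max_image D c hD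
  simp only [D, Finset.mem_filter, Finset.mem_product] at h₀ hmax
  obtain ⟨⟨hp₀, hq₀⟩, hne₀⟩ := h₀
  -- At equality this gives the similar ordering; for larger `s` it forces injectivity.
  have key : ∀ s, c (p₀, q₀) ≤ s → ∀ p ∈ Q, ∀ q ∈ Q,
      (s - c (p₀, q₀)) * (u p - u q) ^ 2 ≤
        (u p - u q) * ((w p + s * u p) - (w q + s * u q)) := by
    intro s hs p hp q hq
    by_cases h : u p = u q
    · simp [h]
    · have h1 := hmax (p, q) ⟨⟨hp, hq⟩, h⟩
      have h2 : c (p, q) * (u p - u q) = -(w p - w q) :=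
        div_mul_cancel₀ _ (sub_ne_zero.2 h)
      have h3 : (u p - u q) * ((w p + s * u p) - (w q + s * u q)) =
          (s - c (p, q)) * (u p - u q) ^ 2 := by
        linear_combination (u p - u q) * h2
      rw [h3]
      gcongr
  refine ⟨c (p₀, q₀), fun h => hne₀ (congrArg u (h hp₀ hq₀ ?_)), fun p hp q hq => ?_,
    fun s hs p hp q hq h => ?_⟩
  · have h2 : c (p₀, q₀) * (u p₀ - u q₀) = -(w p₀ - w q₀) :=
      div_mul_cancel₀ _ (sub_ne_zero.2 hne₀)
    change w p₀ + c (p₀, q₀) * u p₀ = w q₀ + c (p₀, q₀) * u q₀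
    linear_combination h2
  · simpa using key _ le_rfl p hp q hq
  · have h1 := key s hs.le p hp q hq
    have h' : w p + s * u p = w q + s * u q := h
    rw [h', sub_self, mul_zero] at h1
    have h2 : (u p - u q) ^ 2 = 0 :=
      le_antisymm (nonpos_of_mul_nonpos_right h1 (sub_pos.2 hs)) (sq_nonneg _)
    have hupq : u p = u q := sub_eq_zero.1 (pow_eq_zero_iff two_ne_zero |>.1 h2)
    refine hinj p hp q hq hupq ?_
    rw [hupq] at h'
    exact add_right_cancel h'

/-- The numbers of points in the images of a finite planar set under the nonzero linear forms
cannot all lie in a set of integers `≥ 2` of which each is more than twice any smaller one. -/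
theorem not_forall_card_image_linearForm_mem (Q : Finset (ℝ × ℝ)) (A : Set ℕ)
    (hA : ∀ k ∈ A, 2 ≤ k) (hgap : ∀ k ∈ A, ∀ l ∈ A, k < l → 2 * k < l) :
    ¬ ∀ α β : ℝ, (α ≠ 0 ∨ β ≠ 0) → (Q.image fun z => α * z.1 + β * z.2).card ∈ A := by
  classical
  intro h
  have hQ : 1 < Q.card :=
    (hA _ (h 1 0 (Or.inl one_ne_zero))).trans Finset.card_image_le
  obtain ⟨p, hp, q, hq, hpq⟩ := Finset.one_lt_card.1 hQ
  obtain ⟨α, β, hαβ, hker⟩ : ∃ α β : ℝ, (α ≠ 0 ∨ β ≠ 0) ∧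
      α * p.1 + β * p.2 = α * q.1 + β * q.2 := by
    -- The form orthogonal to `p - q`.
    refine ⟨p.2 - q.2, q.1 - p.1, ?_, by ring⟩
    by_contra! h'
    exact hpq (Prod.ext (sub_eq_zero.1 h'.2).symm (sub_eq_zero.1 h'.1))
  have hpos : α ^ 2 + β ^ 2 ≠ 0 := by
    rcases hαβ with h' | h' <;> positivity
  let u : ℝ × ℝ → ℝ := fun z => α * z.1 + β * z.2
  -- The form `u` turned by a right angle: the pair `(u, w)` has determinant `α ^ 2 + β ^ 2`.
  let w : ℝ × ℝ → ℝ := fun z => -β * z.1 + α * z.2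
  have hinj : ∀ p q : ℝ × ℝ, u p = u q → w p = w q → p = q := by
    intro p q h1 h2
    simp only [u, w] at h1 h2
    refine Prod.ext (mul_left_cancel₀ hpos ?_) (mul_left_cancel₀ hpos ?_)
    · linear_combination α * h1 - β * h2
    · linear_combination β * h1 + α * h2
  have hu : (Q.image u).card ∈ A := h α β hαβ
  have hpencil : ∀ s : ℝ, (Q.image fun z => w z + s * u z).card ∈ A := by
    intro s
    have := h (-β + s * α) (α + s * β) (by
      by_contra! h'
      apply hpos
      linear_combination α * h'.2 - β * h'.1)
    convert this using 3
    ext z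
    simp only [u, w]
    ring
  -- Here `2 ≤ k` matters: `u` is not constant on `Q`, so the pencil does have a non-injective
  -- member.
  obtain ⟨t, ht, hmono, hgen⟩ :=
    exists_last_not_injOn Q u w (fun p _ q _ => hinj p q) (hA _ hu)
  have hQA : Q.card ∈ A := by
    have := hpencil (t + 1)
    rwa [Finset.card_image_of_injOn (hgen _ (lt_add_one t))] at this
  have hlt : ∀ f : ℝ × ℝ → ℝ, ¬ Set.InjOn f Q → (Q.image f).card < Q.card := fun f hf =>
    lt_of_le_of_ne Finset.card_image_le fun h' => hf (Finset.card_image_iff.1 h')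
  have h1 := hgap _ hu _ hQA (hlt u fun h' => hpq (h' hp hq hker))
  have h2 := hgap _ (hpencil t) _ hQA (hlt _ ht)
  have h3 := card_le_card_image_add_card_image Q u (fun z => w z + t * u z) hmono
    fun p _ q _ e1 e2 => hinj p q e1 (by
      simp only [e1] at e2
      exact add_right_cancel e2)
  omega

theorem mem_accumulationPoints_iff_mapClusterPt (x : ℓ^∞(ℕ, ℝ)) (η : ℝ) :
    η ∈ accumulationPoints x ↔ MapClusterPt η atTop x := by
  rw [Metric.nhds_basis_ball.mapClusterPt_iff_frequently]
  refine forall₂_congr fun ε _ => ?_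
  rw [Nat.frequently_atTop_iff_infinite]
  rfl

/-- The accumulation points of a linear combination of two bounded sequences are the values of
the linear form at the joint cluster points. -/
theorem accumulationPoints_smul_add_smul (x y : ℓ^∞(ℕ, ℝ)) (α β : ℝ) :
    accumulationPoints (α • x + β • y) =
      (fun z : ℝ × ℝ => α * z.1 + β * z.2) ''
        {z | MapClusterPt z atTop fun n => (x n, y n)} := by
  have hcoe : ⇑(α • x + β • y) = fun n => α * x n + β * y n := rfl
  have hL : Continuous fun z : ℝ × ℝ => α * z.1 + β * z.2 := by fun_prop
  ext η
  rw [mem_accumulationPoints_iff_mapClusterPt, hcoe]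
  constructor
  · intro h
    obtain ⟨U, hU, hη⟩ := mapClusterPt_iff_ultrafilter.1 h
    -- Boundedness makes the pair converge along the ultrafilter that already sends the combination
    -- to `η`.
    have hK : IsCompact (Metric.closedBall (0 : ℝ × ℝ) (max ‖x‖ ‖y‖)) :=
      isCompact_closedBall _ _
    obtain ⟨z, -, hz⟩ := hK.ultrafilter_le_nhds (U.map fun n => (x n, y n)) (by
      refine le_principal_iff.2 (Ultrafilter.mem_map.2 (Filter.univ_mem' fun n => ?_))
      change (x n, y n) ∈ Metric.closedBall (0 : ℝ × ℝ) _
      rw [mem_closedBall_zero_iff, Prod.norm_mk]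
      exact max_le_max (lp.norm_apply_le_norm ENNReal.top_ne_zero x n)
        (lp.norm_apply_le_norm ENNReal.top_ne_zero y n))
    have hz' : Tendsto (fun n => (x n, y n)) U (𝓝 z) := hz
    exact ⟨z, mapClusterPt_iff_ultrafilter.2 ⟨U, hU, hz'⟩,
      tendsto_nhds_unique ((hL.tendsto z).comp hz') hη⟩
  · rintro ⟨z, hz, rfl⟩
    exact MapClusterPt.continuousAt_comp hL.continuousAt hz

/-- A set of integers `≥ 2`, each more than twice any smaller one, does not yield a `2`-lineable
set of sequences. -/
theorem not_isLineable_two_of_subset (A : Set ℕ) (M : Set ℓ^∞(ℕ, ℝ))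
    (hM : ∀ x ∈ M, ∃ k ∈ A, x ∈ seqWithAccumulationPoints (k : Cardinal))
    (hA : ∀ k ∈ A, 2 ≤ k) (hgap : ∀ k ∈ A, ∀ l ∈ A, k < l → 2 * k < l) :
    ¬ IsLineable ℝ 2 M := by
  classical
  rintro ⟨V, hV, hVM⟩
  obtain ⟨b⟩ : Nonempty (Module.Basis (Fin 2) ℝ V) := by
    have hfr : Module.finrank ℝ V = 2 := Module.finrank_eq_of_rank_eq hV
    have : FiniteDimensional ℝ V := Module.finite_of_finrank_pos (by omega)
    exact ⟨Module.finBasisOfFinrankEq ℝ V hfr⟩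
  set x : ℓ^∞(ℕ, ℝ) := ((b 0 : V) : ℓ^∞(ℕ, ℝ))
  set y : ℓ^∞(ℕ, ℝ) := ((b 1 : V) : ℓ^∞(ℕ, ℝ))
  set P : Set (ℝ × ℝ) := {z | MapClusterPt z atTop fun n => (x n, y n)}
  have hmem : ∀ α β : ℝ, (α ≠ 0 ∨ β ≠ 0) →
      ∃ k ∈ A, Cardinal.mk ((fun z : ℝ × ℝ => α * z.1 + β * z.2) '' P) = k := by
    intro α β hαβ
    have hne : α • x + β • y ≠ 0 := by
      intro h0
      have h0' : α • b 0 + β • b 1 = 0 := Subtype.ext h0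
      have := LinearIndependent.pair_iff.1
        (show LinearIndependent ℝ ![b 0, b 1] by
          convert b.linearIndependent using 1
          ext i
          fin_cases i <;> rfl) α β h0'
      tauto
    have hin : α • x + β • y ∈ V :=
      V.add_mem (V.smul_mem _ (b 0).2) (V.smul_mem _ (b 1).2)
    obtain ⟨k, hk, hxk⟩ := hM _ ((hVM hin).resolve_right hne)
    refine ⟨k, hk, ?_⟩
    rw [← accumulationPoints_smul_add_smul]
    exact hxk
  have hfin : ∀ α β : ℝ, (α ≠ 0 ∨ β ≠ 0) →
      ((fun z : ℝ × ℝ => α * z.1 + β * z.2) '' P).Finite := by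
    intro α β hαβ
    obtain ⟨k, -, hk⟩ := hmem α β hαβ
    exact Cardinal.lt_aleph0_iff_set_finite.1 (hk ▸ Cardinal.natCast_lt_aleph0)
  have hP : P.Finite := by
    -- `P` lies in the product of its two coordinate projections.
    refine ((hfin 1 0 (by simp)).prod (hfin 0 1 (by simp))).subset fun z hz => ?_
    exact ⟨⟨z, hz, by simp⟩, ⟨z, hz, by simp⟩⟩
  refine not_forall_card_image_linearForm_mem hP.toFinset A hA hgap fun α β hαβ => ?_
  obtain ⟨k, hk, hcard⟩ := hmem α β hαβ
  convert hk
  rw [← Nat.cast_inj (R := Cardinal.{0}), ← hcard, ← Cardinal.mk_coe_finset,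
    ← Finset.coe_sort_coe, Finset.coe_image, hP.coe_toFinset]

theorem not_isLineable_two_iUnion (a : ℕ → ℕ) (ha : StrictMono a) (h0 : 2 ≤ a 0)
    (hgap : ∀ n : ℕ, 2 * a n < a (n + 1)) :
    ¬ IsLineable ℝ 2 (⋃ n : ℕ, seqWithAccumulationPoints (a n : Cardinal)) := by
  refine not_isLineable_two_of_subset (Set.range a) _ ?_ ?_ ?_
  · intro x hx
    obtain ⟨n, hn⟩ := Set.mem_iUnion.1 hx
    exact ⟨a n, ⟨n, rfl⟩, hn⟩
  · rintro _ ⟨n, rfl⟩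
    exact h0.trans (ha.monotone n.zero_le)
  · rintro _ ⟨m, rfl⟩ _ ⟨n, rfl⟩ hmn
    -- Consecutive gaps suffice, since `a (m + 1) ≤ a n` for `m < n`.
    exact (hgap m).trans_le (ha.monotone (ha.lt_iff_lt.1 hmn))

theorem iUnion_subtype_le_eq_iUnion_add {X : Type*} (s : ℕ → Set X) (k : ℕ) :
    (⋃ n : {n : ℕ // k ≤ n}, s n) = ⋃ n : ℕ, s (n + k) := by
  ext x
  simp only [Set.mem_iUnion, Subtype.exists, exists_prop]
  constructor
  · rintro ⟨n, hn, hx⟩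
    exact ⟨n - k, by rwa [Nat.sub_add_cancel hn]⟩
  · rintro ⟨n, hx⟩
    exact ⟨n + k, Nat.le_add_left k n, hx⟩

theorem mainTheorem8 :
    (∀ a : ℕ → ℕ, StrictMono a → 2 ≤ a 0 → (∀ n : ℕ, 2 * a n < a (n + 1)) →
      ¬ IsLineable ℝ 2 (⋃ n : ℕ, seqWithAccumulationPoints (a n : Cardinal))) ∧
    ¬ IsLineable ℝ 2
      (⋃ n : {n : ℕ // 2 ≤ n}, seqWithAccumulationPoints (((n : ℕ)! : ℕ) : Cardinal)) ∧
    ¬ IsLineable ℝ 2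
      (⋃ n : {n : ℕ // 1 ≤ n}, seqWithAccumulationPoints ((3 ^ (n : ℕ) : ℕ) : Cardinal)) := by
  refine ⟨not_isLineable_two_iUnion, ?_, ?_⟩
  · rw [iUnion_subtype_le_eq_iUnion_add
      (fun n => seqWithAccumulationPoints ((n ! : ℕ) : Cardinal)) 2]
    have hgap : ∀ n : ℕ, 2 * (n + 2)! < (n + 1 + 2)! := fun n => by
      rw [show n + 1 + 2 = (n + 2) + 1 by ring, Nat.factorial_succ (n + 2)]
      exact Nat.mul_lt_mul_of_pos_right (by omega) (Nat.factorial_pos _)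
    exact not_isLineable_two_iUnion (fun n => (n + 2)!)
      (strictMono_nat_of_lt_succ fun n => by have := hgap n; omega)
      (by decide) hgap
  · rw [iUnion_subtype_le_eq_iUnion_add
      (fun n => seqWithAccumulationPoints ((3 ^ n : ℕ) : Cardinal)) 1]
    have hgap : ∀ n : ℕ, 2 * 3 ^ (n + 1) < 3 ^ (n + 1 + 1) := fun n => by
      have : 0 < 3 ^ (n + 1) := by positivity
      rw [pow_succ 3 (n + 1)]
      omega
    exact not_isLineable_two_iUnion (fun n => 3 ^ (n + 1))
      (strictMono_nat_of_lt_succ fun n => by have := hgap n; omega)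
      (by norm_num) hgap
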